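/- Throughout, $T_n$ is the $n$-th Chebyshev polynomial of the first kind and $\alpha_n[f]=\frac{2}{\pi}\int_{-1}^{1}\frac{f(t)T_n(t)}{\sqrt{1-t^2}}\,dt$. For a real $k\times k$ matrix $A$ put $\mathcal S_N(f)(A)=\tfrac12\alpha_0[f]\,I+\sum_{n=1}^{N}\alpha_n[f]\,T_n(A)$. If $A$ has real spectrum and Jordan form $A=Z^{-1}JZ$, $J=\operatorname{diag}(J_1,\dots,J_p)$, where $J_i$ is the upper triangular Jordan block of size $k_i$ with eigenvalue $\lambda_i$, then $f(A)=Z^{-1}\operatorname{diag}(f(J_1),\dots,f(J_p))Z$, where $f(J_i)$ is the upper triangular matrix with $(a,b)$ entry $f^{(b-a)}(\lambda_i)/(b-a)!$ for $a\le b$ (derivatives taken in $[-1,1]$, one-sided at the end points). For $0<\delta<1$, a real matrix $A$ with real spectrum and spectral radius $\rho(A)\le 1$ is called $\delta$-condense if every eigenvalue of $A$ in $[-1,-\delta]\cup[\delta,1]$ is semisimple (its algebraic and geometric multiplicities are equal). A matrix norm is a submultiplicative norm on the real $k\times k$ matrices. **Statement.** Let $m\ge 1$ and $\ell\ge 0$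 be integers, $0<\delta<1$, and let $f\in C^{m+\ell-1}([-1,1])$ be such that $f^{(m+\ell-1)}$ is absolutely continuous and $f^{(m+\ell)}$ (which exists almost everywhere) is of bounded variation, i.e. agrees almost everywhere with a function of bounded variation on $[-1,1]$. Then there is a constant $c\ge 0$, depending only on $f,m,\ell,\delta$, such that for every $k$, every matrix norm $\|\cdot\|$ on the real $k\times k$ matrices, every $\delta$-condense matrix $A$ of size $k\times k$, and every Jordan form $A=Z^{-1}JZ$ whose largest block has size $m$: 1. the number $\kappa=\sup_{n\ge1} n^{-(m-1)}\|T_n(A)\|$ is finite, and $$\|\mathcal S_N(f)(A)-f(A)\|\le \frac{C}{(N-\ell)^{\ell}}\quad\text{for all } N>\ell,\qquad C=c\,\kappa .$$ In particular, for given $A$ and $\|\cdot\|$ the constant $C$ does not depend on $N$, and it depends on $k$, $A$ and $\|\cdot\|$ only through $\kappa$. 2. If $\gamma$ is such that $\|B\|\le\gamma$ for every block diagonal matrix $B$ that is partitioned as $J$ is and whose entries have absolute value at most $1$, then the same estimate holds with $C=c\,\gamma\,\|Z^{-1}\|\,\|Z\|$. -/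

import Mathlib

noncomputable section

/-- The Chebyshev coefficient `α_n[f] = (2/π) ∫_{-1}^1 f(t) T_n(t) / √(1 - t²) dt`. -/
def chebyshevCoeff (f : ℝ → ℝ) (n : ℕ) : ℝ :=
  2 / Real.pi *
    ∫ t in (-1 : ℝ)..1, f t * (Polynomial.Chebyshev.T ℝ n).eval t / Real.sqrt (1 - t ^ 2)

/-- The matrix `T_n(A)`. -/
def chebyshevMatrix {k : ℕ} (n : ℕ) (A : Matrix (Fin k) (Fin k) ℝ) :
    Matrix (Fin k) (Fin k) ℝ :=
  Polynomial.aeval A (Polynomial.Chebyshev.T ℝ n)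

/-- The truncated matrix Chebyshev expansion: the sum of `α_n[f] T_n(A)` over `0 ≤ n ≤ N`, the
term `n = 0` being halved. -/
def chebyshevPartialSum {k : ℕ} (N : ℕ) (f : ℝ → ℝ) (A : Matrix (Fin k) (Fin k) ℝ) :
    Matrix (Fin k) (Fin k) ℝ :=
  (chebyshevCoeff f 0 / 2) • chebyshevMatrix 0 A +
    ∑ n ∈ Finset.Icc 1 N, chebyshevCoeff f n • chebyshevMatrix n A

/-- The upper triangular Jordan block with eigenvalue `μ` and size `s`. -/
def jordanBlock (s : ℕ) (μ : ℝ) : Matrix (Fin s) (Fin s) ℝ :=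
  Matrix.of fun a b => if a = b then μ else if (a : ℕ) + 1 = b then 1 else 0

/-- `f` applied to a Jordan block: the upper triangular matrix with entries
`f^{(b-a)}(μ) / (b-a)!` for `a ≤ b`. Derivatives are those of `f` on `[-1,1]`, one-sided at the
end points. -/
def functionOfJordanBlock (f : ℝ → ℝ) (s : ℕ) (μ : ℝ) : Matrix (Fin s) (Fin s) ℝ :=
  Matrix.of fun a b =>
    if a ≤ b then
      iteratedDerivWithin ((b : ℕ) - a) f (Set.Icc (-1) 1) μ / (((b : ℕ) - a).factorial : ℝ)
    else 0

/-- A (real) Jordan decomposition `A = Z⁻¹ J Z`, where `J` is block diagonal with Jordan blocks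
on its diagonal. The bijection `e` numbers the rows of the blocks by `Fin k`. -/
structure JordanDecomposition {k : ℕ} (A : Matrix (Fin k) (Fin k) ℝ) where
  /-- number of blocks -/
  p : ℕ
  /-- sizes of the blocks -/
  size : Fin p → ℕ
  size_pos : ∀ i, 0 < size i
  /-- eigenvalues of the blocks -/
  ev : Fin p → ℝ
  e : (Σ i, Fin (size i)) ≃ Fin k
  Z : (Matrix (Fin k) (Fin k) ℝ)ˣ
  eq : A = (Z⁻¹).val *
    Matrix.reindex e e (Matrix.blockDiagonal' fun i => jordanBlock (size i) (ev i)) * Z.val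

namespace JordanDecomposition

variable {k : ℕ} {A : Matrix (Fin k) (Fin k) ℝ}

/-- The block diagonal matrix with the given blocks, partitioned as the Jordan form is. -/
def blockDiag (D : JordanDecomposition A)
    (B : ∀ i, Matrix (Fin (D.size i)) (Fin (D.size i)) ℝ) : Matrix (Fin k) (Fin k) ℝ :=
  Matrix.reindex D.e D.e (Matrix.blockDiagonal' B)

/-- The size of the largest Jordan block. -/
def maxBlockSize (D : JordanDecomposition A) : ℕ := Finset.univ.sup D.size

/-- The matrix function `f(A) = Z⁻¹ f(J) Z`. -/
def apply (D : JordanDecomposition A) (f : ℝ → ℝ) : Matrix (Fin k) (Fin k) ℝ :=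
  (D.Z⁻¹).val *
    D.blockDiag (fun i => functionOfJordanBlock f (D.size i) (D.ev i)) * D.Z.val

end JordanDecomposition

/-- `δ`-condense matrices: the spectrum is real, the spectral radius is at most one, and every
eigenvalue in `[-1,-δ] ∪ [δ,1]` is semisimple (its algebraic and geometric multiplicities
coincide). -/
structure IsCondense {k : ℕ} (δ : ℝ) (A : Matrix (Fin k) (Fin k) ℝ) : Prop where
  real_spectrum : A.charpoly.Splits
  spectralRadius_le : spectralRadius ℝ A ≤ 1
  semisimple : ∀ μ : ℝ, Module.End.HasEigenvalue (Matrix.toLin' A) μ →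
    μ ∈ Set.Icc (-1) (-δ) ∪ Set.Icc δ 1 →
    A.charpoly.rootMultiplicity μ =
      Module.finrank ℝ (Module.End.eigenspace (Matrix.toLin' A) μ)

/-- `f ∈ C^p([-1,1])`, `f^{(p)}` is absolutely continuous on `[-1,1]`, and `f^{(p+1)}`, which
therefore exists almost everywhere, is of bounded variation, i.e. agrees almost everywhere with a
function of bounded variation. -/
structure HasBVDerivative (p : ℕ) (f : ℝ → ℝ) : Prop where
  contDiffOn : ContDiffOn ℝ p f (Set.Icc (-1) 1)
  absolutelyContinuous :
    AbsolutelyContinuousOnInterval (iteratedDerivWithin p f (Set.Icc (-1) 1)) (-1) 1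
  boundedVariation : ∃ g : ℝ → ℝ, BoundedVariationOn g (Set.Icc (-1) 1) ∧
    ∀ᵐ x ∂(MeasureTheory.volume.restrict (Set.Icc (-1 : ℝ) 1)),
      HasDerivAt (iteratedDerivWithin p f (Set.Icc (-1) 1)) (g x) x

end

open Real Set MeasureTheory intervalIntegral Filter Topology

/-! Substituting `t = cos θ` turns `α_n[f]` into a cosine moment of `f ∘ cos`. Each integration by
parts gains a factor `1/n`: the `sin θ` produced by the chain rule combines with `sin (nθ)` into two
cosines of neighbouring frequency, so the result is again a difference of cosine moments, now of the
derivative. After `m + ℓ` such steps a function of bounded variation is left, whose moments are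
themselves `O(1/n)`; hence `|α_n[f]| ≤ C n^{-(m+ℓ+1)}`
(`HasBVDerivative.exists_abs_chebyshevCoeff_le`). Since `‖T_n(A)‖ ≤ κ n^{m-1}`, the `n`-th term of
the matrix series is at most `C κ n^{-ℓ-2}`, and the tail beyond `N` is at most `C κ (N-ℓ)^{-ℓ} ∑
n^{-2}`. It remains to see that the series converges to `f(A)` and that `κ` is finite. On a Jordan
block, `T_n` has entries `T_n^{(j)}(λ)/j!`. Near `±1` these derivatives are too large, but for a
condense matrix every block of size at least two has `|λ| < δ`, where the differential equation of
`T_n` gives `T_n^{(j)} = O(n^j)`. So the scalar series may be differentiated termwise there, while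
blocks of size one need only its values. The same bound yields `κ ≤ K ‖Z⁻¹‖ ‖Z‖ γ`, which gives the
second estimate. -/

/-! ### Decay of cosine moments and Chebyshev coefficients -/

/-- The integral `∫_0^π h(cos θ) cos(n θ) dθ`. -/
noncomputable def cosMoment (h : ℝ → ℝ) (n : ℕ) : ℝ :=
  ∫ θ in (0 : ℝ)..π, h (cos θ) * cos (n * θ)

theorem chebyshevCoeff_eq_cosMoment (f : ℝ → ℝ) (n : ℕ) :
    chebyshevCoeff f n = 2 / π * cosMoment f n := by
  unfold chebyshevCoeff cosMoment
  congr 1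
  have h := Polynomial.Chebyshev.integral_measureT_eq_integral_cos
    (f := fun t => f t * (Polynomial.Chebyshev.T ℝ n).eval t)
  rw [Polynomial.Chebyshev.integral_measureT] at h
  simpa [div_eq_mul_inv] using h

/-- A shift by the half period `τ = π/n` changes the sign of the cosine, so up to two end pieces of
length `τ` twice the integral is that of `(h θ - h (θ + τ)) cos (nθ)`. By monotonicity the
increments of `h` have one sign, and their integral telescopes to two more end pieces. -/
theorem Monotone.abs_integral_mul_cos_le {h : ℝ → ℝ} (hh : Monotone h) {M : ℝ}
    (hM : ∀ x, |h x| ≤ M) {n : ℕ} (hn : 1 ≤ n) :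
    |∫ θ in (0 : ℝ)..π, h θ * cos (n * θ)| ≤ 2 * π * M / n := by
  have hn0 : (0 : ℝ) < n := by exact_mod_cast hn
  set τ : ℝ := π / n with hτ
  have hτ0 : 0 < τ := div_pos pi_pos hn0
  have hI : ∀ a b, IntervalIntegrable h volume a b := fun a b => hh.intervalIntegrable
  have hIs : ∀ a b, IntervalIntegrable (fun x => h (x + τ)) volume a b := fun a b =>
    (hh.comp (monotone_id.add_const τ)).intervalIntegrable
  have hc : Continuous fun θ : ℝ => cos (n * θ) := by fun_prop
  have hIc : ∀ a b, IntervalIntegrable (fun θ => h θ * cos (n * θ)) volume a b := fun a b =>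
    (hI a b).mul_continuousOn hc.continuousOn
  have hIsc : ∀ a b, IntervalIntegrable (fun θ => h (θ + τ) * cos (n * θ)) volume a b :=
    fun a b => (hIs a b).mul_continuousOn hc.continuousOn
  have hshift : ∫ θ in (0 : ℝ)..π, h (θ + τ) * cos (n * θ) =
      - ∫ θ in τ..(π + τ), h θ * cos (n * θ) := by
    have := intervalIntegral.integral_comp_add_right (a := 0) (b := π)
      (fun θ => h θ * cos (n * θ)) τ
    rw [zero_add] at this
    rw [← this, ← intervalIntegral.integral_neg]
    refine intervalIntegral.integral_congr fun θ _ => ?_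
    have : (n : ℝ) * (θ + τ) = n * θ + π := by rw [hτ]; field_simp
    simp only [this, cos_add_pi]; ring
  have hsplit : ∫ θ in τ..(π + τ), h θ * cos (n * θ) =
      (∫ θ in (0 : ℝ)..π, h θ * cos (n * θ)) + (∫ θ in π..(π + τ), h θ * cos (n * θ))
        - ∫ θ in (0 : ℝ)..τ, h θ * cos (n * θ) := by
    rw [integral_add_adjacent_intervals (hIc _ _) (hIc _ _), eq_sub_iff_add_eq, add_comm,
      integral_add_adjacent_intervals (hIc _ _) (hIc _ _)]
  have hend : ∀ a, |∫ θ in a..(a + τ), h θ * cos (n * θ)| ≤ M * τ := fun a => by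
    have := norm_integral_le_of_norm_le_const (a := a) (b := a + τ) (C := M)
      (f := fun θ => h θ * cos (n * θ)) fun x _ => by
        rw [norm_mul]
        calc ‖h x‖ * ‖cos (n * x)‖ ≤ M * 1 :=
              mul_le_mul (hM x) (abs_cos_le_one _) (norm_nonneg _) ((abs_nonneg _).trans (hM x))
          _ = M := mul_one M
    simpa [abs_of_pos hτ0] using this
  have hend' : ∀ a, |∫ θ in a..(a + τ), h θ| ≤ M * τ := fun a => by
    have := norm_integral_le_of_norm_le_const (a := a) (b := a + τ) (C := M)
      (f := h) fun x _ => hM x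
    simpa [abs_of_pos hτ0] using this
  have hdiff : |(∫ θ in (0 : ℝ)..π, h (θ + τ) * cos (n * θ)) -
      ∫ θ in (0 : ℝ)..π, h θ * cos (n * θ)| ≤ 2 * (M * τ) := by
    rw [← intervalIntegral.integral_sub (hIsc _ _) (hIc _ _)]
    have h1 : ∀ᵐ θ, θ ∈ Ioc 0 π → ‖h (θ + τ) * cos (n * θ) - h θ * cos (n * θ)‖ ≤
        h (θ + τ) - h θ := ae_of_all _ fun θ _ => by
      rw [← sub_mul, norm_mul]
      have : 0 ≤ h (θ + τ) - h θ := sub_nonneg.2 (hh (by linarith))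
      rw [norm_of_nonneg this]
      exact mul_le_of_le_one_right this (abs_cos_le_one _)
    refine (norm_integral_le_of_norm_le pi_pos.le h1 ((hIs _ _).sub (hI _ _))).trans ?_
    rw [intervalIntegral.integral_sub (hIs _ _) (hI _ _),
      intervalIntegral.integral_comp_add_right h τ, zero_add]
    have : ∫ θ in τ..(π + τ), h θ = (∫ θ in (0 : ℝ)..π, h θ) + (∫ θ in π..(π + τ), h θ)
        - ∫ θ in (0 : ℝ)..τ, h θ := by
      rw [integral_add_adjacent_intervals (hI _ _) (hI _ _), eq_sub_iff_add_eq, add_comm,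
        integral_add_adjacent_intervals (hI _ _) (hI _ _)]
    have e1 := abs_le.1 (hend' π)
    have e2 := abs_le.1 (hend' 0)
    rw [zero_add] at e2
    rw [this]; linarith [e1.1, e1.2, e2.1, e2.2]
  have e1 := abs_le.1 (hend π)
  have e2 := abs_le.1 (hend 0)
  have e3 := abs_le.1 hdiff
  rw [zero_add] at e2
  rw [hshift, hsplit] at e3
  have : 2 * π * M / n = 2 * (M * τ) := by rw [hτ]; ring
  rw [this, abs_le]
  constructor <;> linarith [e1.1, e1.2, e2.1, e2.2, e3.1, e3.2]

theorem MonotoneOn.exists_abs_integral_mul_cos_le {φ : ℝ → ℝ} (hφ : MonotoneOn φ (Icc 0 π)) :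
    ∃ C, ∀ n : ℕ, 1 ≤ n → |∫ θ in (0 : ℝ)..π, φ θ * cos (n * θ)| ≤ C / n := by
  -- The shift argument leaves `[0, π]`; extending by constants keeps the function monotone and
  -- bounded.
  set h : ℝ → ℝ := IccExtend pi_pos.le ((Icc 0 π).domRestrict φ) with hh
  have hmono : Monotone h := (hφ.monotone).IccExtend _
  have heq : ∀ x ∈ Icc 0 π, h x = φ x := fun x hx => by
    rw [hh, IccExtend_of_mem _ _ hx]; rfl
  have hM : ∀ x, |h x| ≤ |φ 0| + |φ π| := fun x => by
    have h0 : φ 0 ≤ h x := by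
      rw [hh]
      exact hφ (left_mem_Icc.2 pi_pos.le) (projIcc 0 π pi_pos.le x).2
        (projIcc 0 π pi_pos.le x).2.1
    have h1 : h x ≤ φ π := by
      rw [hh]
      exact hφ (projIcc 0 π pi_pos.le x).2 (right_mem_Icc.2 pi_pos.le)
        (projIcc 0 π pi_pos.le x).2.2
    rw [abs_le]
    constructor <;> linarith [neg_abs_le (φ 0), le_abs_self (φ π), abs_nonneg (φ 0),
      abs_nonneg (φ π)]
  refine ⟨2 * π * (|φ 0| + |φ π|), fun n hn => ?_⟩
  convert hmono.abs_integral_mul_cos_le hM hn using 2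
  refine intervalIntegral.integral_congr fun θ hθ => ?_
  rw [uIcc_of_le pi_pos.le] at hθ
  simp only [heq θ hθ]

theorem BoundedVariationOn.intervalIntegrable {φ : ℝ → ℝ} {a b : ℝ} (hab : a ≤ b)
    (hφ : BoundedVariationOn φ (Icc a b)) : IntervalIntegrable φ volume a b := by
  obtain ⟨p, q, hp, hq, rfl⟩ := hφ.locallyBoundedVariationOn.exists_monotoneOn_sub_monotoneOn
  rw [← uIcc_of_le hab] at hp hq
  exact hp.intervalIntegrable.sub hq.intervalIntegrable

theorem BoundedVariationOn.exists_abs_integral_mul_cos_le {φ : ℝ → ℝ}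
    (hφ : BoundedVariationOn φ (Icc 0 π)) :
    ∃ C, ∀ n : ℕ, 1 ≤ n → |∫ θ in (0 : ℝ)..π, φ θ * cos (n * θ)| ≤ C / n := by
  obtain ⟨p, q, hp, hq, rfl⟩ := hφ.locallyBoundedVariationOn.exists_monotoneOn_sub_monotoneOn
  obtain ⟨C, hC⟩ := hp.exists_abs_integral_mul_cos_le
  obtain ⟨C', hC'⟩ := hq.exists_abs_integral_mul_cos_le
  rw [← uIcc_of_le pi_pos.le] at hp hq
  refine ⟨C + C', fun n hn => ?_⟩
  have hc : Continuous fun θ : ℝ => cos (n * θ) := by fun_prop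
  simp only [Pi.sub_apply, sub_mul]
  rw [intervalIntegral.integral_sub (hp.intervalIntegrable.mul_continuousOn hc.continuousOn)
    (hq.intervalIntegrable.mul_continuousOn hc.continuousOn), add_div]
  exact (abs_sub _ _).trans (add_le_add (hC n hn) (hC' n hn))

theorem BoundedVariationOn.comp_cos {g : ℝ → ℝ} (hg : BoundedVariationOn g (Icc (-1) 1)) :
    BoundedVariationOn (fun θ => g (cos θ)) (Icc 0 π) :=
  ne_top_of_le_ne_top hg
    (eVariationOn.comp_le_of_antitoneOn g cos strictAntiOn_cos.antitoneOn
      fun _ _ => ⟨neg_one_le_cos _, cos_le_one _⟩)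

theorem countable_cos_preimage {s : Set ℝ} (hs : s.Countable) :
    (cos ⁻¹' s ∩ Icc 0 π).Countable := by
  refine (hs.image arccos).mono ?_
  exact fun θ hθ => ⟨cos θ, hθ.1, arccos_cos hθ.2.1 hθ.2.2⟩

/-- Integration by parts, lowering the order of the derivative. -/
theorem cosMoment_eq_of_hasDerivAt {H h : ℝ → ℝ} {s : Set ℝ} (hs : s.Countable)
    (hH : ContinuousOn H (Icc (-1) 1)) (hd : ∀ x ∈ Ioo (-1) 1, x ∉ s → HasDerivAt H (h x) x)
    (hi : IntervalIntegrable (fun θ => h (cos θ)) volume 0 π) {n : ℕ} :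
    ((n + 1 : ℕ) : ℝ) * cosMoment H (n + 1) = (cosMoment h n - cosMoment h (n + 2)) / 2 := by
  have hcos : ContinuousOn (fun θ => H (cos θ)) (uIcc 0 π) :=
    hH.comp continuous_cos.continuousOn fun _ _ => ⟨neg_one_le_cos _, cos_le_one _⟩
  have hci : ∀ k : ℕ, IntervalIntegrable (fun θ => h (cos θ) * cos (k * θ)) volume 0 π :=
    fun k => hi.mul_continuousOn (by fun_prop)
  -- Product-to-sum formula: this is what brings the integral back to cosine moments.
  have hprod : ∀ θ : ℝ, h (cos θ) * -sin θ * sin ((n + 1 : ℕ) * θ) =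
      (h (cos θ) * cos ((n + 2 : ℕ) * θ) - h (cos θ) * cos (n * θ)) / 2 := fun θ => by
    have e1 : ((n + 2 : ℕ) : ℝ) * θ = (n + 1 : ℕ) * θ + θ := by push_cast; ring
    have e2 : (n : ℝ) * θ = (n + 1 : ℕ) * θ - θ := by push_cast; ring
    rw [e1, e2, cos_add, cos_sub]; ring
  have hcc : ContinuousOn (fun θ : ℝ => cos ((n + 1 : ℕ) * θ) * (n + 1 : ℕ)) (uIcc 0 π) := by
    fun_prop
  have hI1 : IntervalIntegrable (fun θ => h (cos θ) * -sin θ * sin ((n + 1 : ℕ) * θ))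
      volume 0 π := by
    simp only [hprod]
    exact ((hci _).sub (hci _)).div_const 2
  have hI2 : IntervalIntegrable
      (fun θ => H (cos θ) * (cos ((n + 1 : ℕ) * θ) * (n + 1 : ℕ))) volume 0 π :=
    (hcos.mul hcc).intervalIntegrable
  -- No boundary terms survive, because `sin ((n + 1) θ)` vanishes at `0` and `π`.
  have key := integral_eq_of_hasDerivAt_off_countable_of_le
    (fun θ => H (cos θ) * sin ((n + 1 : ℕ) * θ))
    (fun θ => h (cos θ) * -sin θ * sin ((n + 1 : ℕ) * θ) +
      H (cos θ) * (cos ((n + 1 : ℕ) * θ) * (n + 1 : ℕ))) pi_pos.le (countable_cos_preimage hs)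
    (by
      rw [← uIcc_of_le pi_pos.le]
      exact hcos.mul (by fun_prop))
    (fun θ hθ => by
      have hθ1 : cos θ ∈ Ioo (-1) 1 := by
        constructor
        · rw [← cos_pi]; exact cos_lt_cos_of_nonneg_of_le_pi hθ.1.1.le le_rfl hθ.1.2
        · rw [← cos_zero]; exact cos_lt_cos_of_nonneg_of_le_pi le_rfl hθ.1.2.le hθ.1.1
      have hθ2 : cos θ ∉ s := fun hmem => hθ.2 ⟨hmem, Ioo_subset_Icc_self hθ.1⟩
      have d1 := (hd _ hθ1 hθ2).comp θ (hasDerivAt_cos θ)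
      have d2 := ((hasDerivAt_id θ).const_mul ((n + 1 : ℕ) : ℝ)).sin
      have d3 := d1.mul d2
      simp only [mul_one, id_eq] at d3
      exact d3)
    (hI1.add hI2)
  rw [intervalIntegral.integral_add hI1 hI2] at key
  simp only [hprod] at key
  rw [intervalIntegral.integral_div, intervalIntegral.integral_sub (hci _) (hci _)] at key
  have e : ∫ θ in (0 : ℝ)..π, H (cos θ) * (cos ((n + 1 : ℕ) * θ) * (n + 1 : ℕ)) =
      ((n + 1 : ℕ) : ℝ) * cosMoment H (n + 1) := by
    rw [cosMoment, ← intervalIntegral.integral_const_mul]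
    exact intervalIntegral.integral_congr fun θ _ => by ring
  rw [e, sin_nat_mul_pi] at key
  simp only [mul_zero, sin_zero, sub_zero] at key
  simp only [cosMoment] at key ⊢
  linarith

theorem exists_abs_cosMoment_le_of_hasDerivAt {H h : ℝ → ℝ} {s : Set ℝ} (hs : s.Countable)
    (hH : ContinuousOn H (Icc (-1) 1)) (hd : ∀ x ∈ Ioo (-1) 1, x ∉ s → HasDerivAt H (h x) x)
    (hi : IntervalIntegrable (fun θ => h (cos θ)) volume 0 π) {q : ℕ}
    (hh : ∃ C, ∀ n : ℕ, 1 ≤ n → |cosMoment h n| ≤ C / (n : ℝ) ^ q) :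
    ∃ C, ∀ n : ℕ, 1 ≤ n → |cosMoment H n| ≤ C / (n : ℝ) ^ (q + 1) := by
  obtain ⟨C, hC⟩ := hh
  have hC0 : 0 ≤ C := by simpa using (abs_nonneg _).trans (hC 1 le_rfl)
  -- The neighbouring indices `n ± 1` cost at most `2 ^ q`, as `n ≤ 2 (n - 1)` for `n ≥ 2`. For `n =
  -- 1` the recursion would involve the moment of index zero, so this case is put into the constant.
  refine ⟨2 ^ q * C + |cosMoment H 1|, fun n hn => ?_⟩
  obtain rfl | hn2 := hn.eq_or_lt
  · simp; positivity
  obtain ⟨k, rfl⟩ : ∃ k, n = k + 2 := ⟨n - 2, by omega⟩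
  have key := cosMoment_eq_of_hasDerivAt hs hH hd hi (n := k + 1)
  have h1 := hC (k + 1) (by omega)
  have h2 := hC (k + 3) (by omega)
  set N : ℝ := ((k + 2 : ℕ) : ℝ) with hN
  have hN0 : 0 < N := by positivity
  have b1 : C / ((k + 1 : ℕ) : ℝ) ^ q ≤ 2 ^ q * C / N ^ q := by
    rw [div_le_div_iff₀ (by positivity) (by positivity)]
    have : N ^ q ≤ 2 ^ q * ((k + 1 : ℕ) : ℝ) ^ q := by
      rw [← mul_pow]
      refine pow_le_pow_left₀ hN0.le ?_ q
      rw [hN]; push_cast; linarith [(Nat.cast_nonneg k : (0 : ℝ) ≤ k)]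
    nlinarith
  have b2 : C / ((k + 3 : ℕ) : ℝ) ^ q ≤ 2 ^ q * C / N ^ q := by
    have h2q : (1 : ℝ) ≤ 2 ^ q := one_le_pow₀ (by norm_num)
    refine div_le_div₀ (by positivity) (by nlinarith) (by positivity) ?_
    refine pow_le_pow_left₀ hN0.le ?_ q
    rw [hN]; push_cast; linarith
  have h3 : N * |cosMoment H (k + 2)| ≤ 2 ^ q * C / N ^ q := by
    rw [← abs_of_pos hN0, ← abs_mul, abs_of_pos hN0]
    have key' : N * cosMoment H (k + 2) = (cosMoment h (k + 1) - cosMoment h (k + 3)) / 2 := key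
    rw [key', abs_div, abs_two]
    have := abs_sub (cosMoment h (k + 1)) (cosMoment h (k + 3))
    linarith
  rw [pow_succ, ← div_div, le_div_iff₀ hN0, mul_comm]
  refine h3.trans (div_le_div_of_nonneg_right ?_ (by positivity))
  linarith [abs_nonneg (cosMoment H 1)]

theorem BoundedVariationOn.countable_not_continuousWithinAt {g : ℝ → ℝ} {s : Set ℝ}
    (hg : BoundedVariationOn g s) : {x ∈ s | ¬ ContinuousWithinAt g s x}.Countable := by
  obtain ⟨p, q, hp, hq, rfl⟩ := hg.locallyBoundedVariationOn.exists_monotoneOn_sub_monotoneOn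
  refine (hp.countable_not_continuousWithinAt.union hq.countable_not_continuousWithinAt).mono
    fun x hx => ?_
  by_contra hcon
  simp only [mem_union, mem_ofPred_eq, not_or, not_and, not_not] at hcon
  exact hx.2 ((hcon.1 hx.1).sub (hcon.2 hx.1))

/-- An absolutely continuous function whose derivative is almost everywhere equal to a function
of bounded variation is differentiable off a countable set. -/
theorem AbsolutelyContinuousOnInterval.exists_countable_hasDerivAt {H g : ℝ → ℝ} {a b : ℝ}
    (hab : a ≤ b) (hH : AbsolutelyContinuousOnInterval H a b)
    (hg : BoundedVariationOn g (Icc a b))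
    (hd : ∀ᵐ x ∂(volume.restrict (Icc a b)), HasDerivAt H (g x) x) :
    ∃ s : Set ℝ, s.Countable ∧ ∀ x ∈ Ioo a b, x ∉ s → HasDerivAt H (g x) x := by
  -- The exceptional set consists of the discontinuities of `g`; elsewhere the fundamental theorem
  -- of calculus applies to `H = H a + ∫ g`.
  refine ⟨_, hg.countable_not_continuousWithinAt, fun x hx hxs => ?_⟩
  have hcw : ContinuousWithinAt g (Icc a b) x := by
    by_contra hcon
    exact hxs ⟨Ioo_subset_Icc_self hx, hcon⟩
  have hcont : ContinuousAt g x := hcw.continuousAt (Icc_mem_nhds hx.1 hx.2)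
  have hgi := hg.intervalIntegrable hab
  have hrep : ∀ y ∈ Icc a b, H y = H a + ∫ t in a..y, g t := fun y hy => by
    have := (hH.mono (c := a) (d := y) (by
      rw [uIcc_of_le hab, uIcc_of_le hy.1]
      exact Icc_subset_Icc_right hy.2)).integral_deriv_eq_sub
    have h2 : ∫ t in a..y, deriv H t = ∫ t in a..y, g t := by
      refine integral_congr_ae ?_
      rw [ae_restrict_iff' measurableSet_Icc] at hd
      filter_upwards [hd] with t ht htm
      rw [uIoc_of_le hy.1] at htm
      exact (ht ⟨htm.1.le, htm.2.trans hy.2⟩).deriv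
    linarith
  have hmeas : StronglyMeasurableAtFilter g (𝓝 x) volume :=
    ⟨Ioc a b, Ioc_mem_nhds hx.1 hx.2,
      ((intervalIntegrable_iff_integrableOn_Ioc_of_le hab).1 hgi).aestronglyMeasurable⟩
  have hder := (integral_hasDerivAt_right (a := a) (b := x)
    (hgi.mono_set (by
      rw [uIcc_of_le hab, uIcc_of_le hx.1.le]
      exact Icc_subset_Icc_right hx.2.le)) hmeas hcont).const_add (H a)
  refine hder.congr_of_eventuallyEq ?_
  filter_upwards [Icc_mem_nhds hx.1 hx.2] with y hy using hrep y hy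

theorem HasBVDerivative.exists_abs_cosMoment_le {p : ℕ} {f : ℝ → ℝ} (hf : HasBVDerivative p f) :
    ∃ C, ∀ n : ℕ, 1 ≤ n → |cosMoment f n| ≤ C / (n : ℝ) ^ (p + 2) := by
  have hu : UniqueDiffOn ℝ (Icc (-1 : ℝ) 1) := uniqueDiffOn_Icc (by norm_num)
  have hcont : ∀ j ≤ p, ContinuousOn (iteratedDerivWithin j f (Icc (-1) 1)) (Icc (-1) 1) :=
    fun j hj => hf.contDiffOn.continuousOn_iteratedDerivWithin (by exact_mod_cast hj) hu
  -- Here `j` is the distance below the top derivative; the case `j = 0` starts from the `O(1/n)`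
  -- moments of `g`.
  have main : ∀ j ≤ p, ∃ C, ∀ n : ℕ, 1 ≤ n →
      |cosMoment (iteratedDerivWithin (p - j) f (Icc (-1) 1)) n| ≤ C / (n : ℝ) ^ (j + 2) := by
    intro j
    induction j with
    | zero =>
      intro _
      obtain ⟨g, hg, hd⟩ := hf.boundedVariation
      obtain ⟨s, hs, hds⟩ :=
        hf.absolutelyContinuous.exists_countable_hasDerivAt (by norm_num) hg hd
      refine exists_abs_cosMoment_le_of_hasDerivAt hs (hcont _ le_rfl) hds
        (hg.comp_cos.intervalIntegrable pi_pos.le) (q := 1) ?_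
      simpa [cosMoment] using hg.comp_cos.exists_abs_integral_mul_cos_le
    | succ j ih =>
      intro hj
      have hlt : p - (j + 1) < p := by omega
      have hsucc : p - (j + 1) + 1 = p - j := by omega
      refine exists_abs_cosMoment_le_of_hasDerivAt (q := j + 2) countable_empty
        (hcont _ hlt.le) (fun x hx _ => ?_) ?_ (ih (by omega))
      · have hdiff := hf.contDiffOn.differentiableOn_iteratedDerivWithin
          (by exact_mod_cast hlt) hu x (Ioo_subset_Icc_self hx)
        have := hdiff.hasDerivWithinAt
        rw [← iteratedDerivWithin_succ, hsucc] at this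
        exact this.hasDerivAt (Icc_mem_nhds hx.1 hx.2)
      · exact ((hcont (p - j) (by omega)).comp continuous_cos.continuousOn
          fun _ _ => ⟨neg_one_le_cos _, cos_le_one _⟩).intervalIntegrable
  simpa using main p le_rfl

theorem HasBVDerivative.exists_abs_chebyshevCoeff_le {p : ℕ} {f : ℝ → ℝ}
    (hf : HasBVDerivative p f) :
    ∃ C, 0 ≤ C ∧ ∀ n : ℕ, 1 ≤ n → |chebyshevCoeff f n| ≤ C / (n : ℝ) ^ (p + 2) := by
  obtain ⟨C, hC⟩ := hf.exists_abs_cosMoment_le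
  have hC0 : 0 ≤ C := by simpa using (abs_nonneg _).trans (hC 1 le_rfl)
  refine ⟨2 / π * C, by positivity, fun n hn => ?_⟩
  rw [chebyshevCoeff_eq_cosMoment, abs_mul, abs_of_pos (by positivity : (0 : ℝ) < 2 / π),
    mul_div_assoc]
  exact mul_le_mul_of_nonneg_left (hC n hn) (by positivity)

/-! ### Pointwise convergence of the Chebyshev series -/

/-- The coefficients of the Chebyshev series, that of index zero being halved. -/
noncomputable def chebyshevSeriesCoeff (f : ℝ → ℝ) (n : ℕ) : ℝ :=
  if n = 0 then chebyshevCoeff f 0 / 2 else chebyshevCoeff f n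

/-- Since `f ∘ cos` is even, folding `[-π, π]` onto `[0, π]` turns the exponential into a cosine. -/
theorem fourierCoeff_comp_cos [Fact (0 < 2 * π)] {f : ℝ → ℝ}
    (F : C(AddCircle (2 * π), ℂ)) (hF : ∀ θ : ℝ, F θ = (f (cos θ) : ℂ)) (n : ℤ) :
    fourierCoeff F n = ((cosMoment f n.natAbs / π : ℝ) : ℂ) := by
  rw [fourierCoeff_eq_intervalIntegral _ _ (-π), show -π + 2 * π = π by ring]
  set G : ℝ → ℂ := fun x => fourier (-n) (x : AddCircle (2 * π)) • F x with hG
  have hGc : Continuous G := by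
    have h1 : Continuous fun x : ℝ => (x : AddCircle (2 * π)) := AddCircle.continuous_mk' _
    exact ((fourier (-n)).continuous.comp h1).smul (F.continuous.comp h1)
  have hGv : ∀ x : ℝ, G x = Complex.exp (-(n * x : ℂ) * Complex.I) * (f (cos x) : ℂ) := fun x => by
    rw [hG]
    simp only [hF, fourier_coe_apply, smul_eq_mul]
    congr 2
    have : (π : ℂ) ≠ 0 := by exact_mod_cast pi_ne_zero
    push_cast
    field_simp
  have hsum : ∀ x : ℝ, G (-x) + G x =
      ((2 * (f (cos x) * cos (n.natAbs * x)) : ℝ) : ℂ) := fun x => by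
    have hcos : cos (n.natAbs * x) = cos (n * x) := by
      rcases Int.natAbs_eq n with h | h
      · conv_rhs => rw [h]
        simp
      · conv_rhs => rw [h]
        simp
    rw [hGv, hGv, cos_neg, hcos]
    push_cast
    rw [Complex.cos]
    ring_nf
  have hint : ∫ x in (-π)..π, G x = ((2 * cosMoment f n.natAbs : ℝ) : ℂ) := by
    rw [← integral_add_adjacent_intervals (hGc.intervalIntegrable (-π) 0)
      (hGc.intervalIntegrable 0 π)]
    have : ∫ x in (-π)..0, G x = ∫ x in (0 : ℝ)..π, G (-x) := by
      rw [intervalIntegral.integral_comp_neg, neg_zero]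
    rw [this, ← intervalIntegral.integral_add (f := fun x => G (-x))
      ((hGc.comp continuous_neg).intervalIntegrable 0 π) (hGc.intervalIntegrable 0 π)]
    simp only [hsum]
    rw [intervalIntegral.integral_ofReal, intervalIntegral.integral_const_mul, cosMoment]
  rw [hint, Complex.real_smul, ← Complex.ofReal_mul]
  congr 1
  field_simp

/-- This is the Fourier series of the continuous function `f ∘ cos`, whose coefficients are
summable, evaluated at `arccos x`. -/
theorem hasSum_chebyshevSeries {f : ℝ → ℝ} (hf : ContinuousOn f (Icc (-1) 1))
    (hs : Summable (chebyshevCoeff f)) {x : ℝ} (hx : x ∈ Icc (-1) 1) :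
    HasSum (fun n : ℕ => chebyshevSeriesCoeff f n * (Polynomial.Chebyshev.T ℝ n).eval x)
      (f x) := by
  have : Fact (0 < 2 * π) := ⟨two_pi_pos⟩
  have hc : Continuous fun θ => f (cos θ) := by
    rw [← continuousOn_univ]
    exact hf.comp continuous_cos.continuousOn fun _ _ => ⟨neg_one_le_cos _, cos_le_one _⟩
  have hper : Function.Periodic (fun θ : ℝ => (f (cos θ) : ℂ)) (2 * π) := fun θ => by
    simp only [cos_add_two_pi]
  let F : C(AddCircle (2 * π), ℂ) :=
    ⟨hper.lift, continuous_coinduced_dom.2 (Complex.continuous_ofReal.comp hc)⟩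
  have hF : ∀ θ : ℝ, F θ = (f (cos θ) : ℂ) := fun θ => hper.lift_coe θ
  have hco := fourierCoeff_comp_cos F hF
  have hval : ∀ n : ℕ, cosMoment f n / π = chebyshevCoeff f n / 2 := fun n => by
    rw [chebyshevCoeff_eq_cosMoment]; field_simp
  have hnat : Summable fun n : ℕ => ((cosMoment f n / π : ℝ) : ℂ) := by
    simp only [hval]
    exact Complex.summable_ofReal.2 (hs.div_const 2)
  have hsum : Summable (fourierCoeff F) := by
    refine Summable.of_nat_of_neg ?_ ?_
    · simpa [hco] using hnat
    · simpa [hco] using hnat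
  obtain ⟨θ, hθ⟩ : ∃ θ, cos θ = x := ⟨arccos x, cos_arccos hx.1 hx.2⟩
  have h1 := (has_pointwise_sum_fourier_series_of_summable hsum (θ : AddCircle (2 * π))).nat_add_neg
  have hterm : ∀ n : ℕ, fourierCoeff F n • fourier n (θ : AddCircle (2 * π)) +
      fourierCoeff F (-n) • fourier (-n) (θ : AddCircle (2 * π)) =
      ((chebyshevCoeff f n * cos (n * θ) : ℝ) : ℂ) := fun n => by
    have hπ : (π : ℂ) ≠ 0 := by exact_mod_cast pi_ne_zero
    have e1 : (2 * π * Complex.I * ((n : ℤ) : ℂ) * θ / ((2 * π : ℝ) : ℂ) : ℂ) =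
        n * θ * Complex.I := by push_cast; field_simp
    have e2 : (2 * π * Complex.I * ((-n : ℤ) : ℂ) * θ / ((2 * π : ℝ) : ℂ) : ℂ) =
        -(n * θ) * Complex.I := by push_cast; field_simp
    rw [hco, hco, fourier_coe_apply, fourier_coe_apply, e1, e2, Int.natAbs_neg, Int.natAbs_natCast,
      hval]
    push_cast
    rw [Complex.cos]
    simp only [smul_eq_mul]
    ring
  simp only [hterm, hF] at h1
  rw [hco, fourier_zero, Int.natAbs_zero, hval, hθ, smul_eq_mul, mul_one, ← Complex.ofReal_add,
    Complex.hasSum_ofReal] at h1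
  -- Pairing `n` with `-n` counts the constant term twice; removing one copy produces the halved
  -- coefficient.
  have h2 := h1.sub (hasSum_ite_eq 0 (chebyshevCoeff f 0 / 2))
  rw [add_sub_cancel_right] at h2
  suffices h : ∀ n : ℕ, chebyshevSeriesCoeff f n * (Polynomial.Chebyshev.T ℝ n).eval x =
      chebyshevCoeff f n * cos (n * θ) - if n = 0 then chebyshevCoeff f 0 / 2 else 0 by
    simpa only [h] using h2
  intro n
  rw [← hθ, Polynomial.Chebyshev.T_real_cos, chebyshevSeriesCoeff]
  split_ifs with h
  · subst h; simp; ring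
  · simp

/-! ### Derivatives of Chebyshev polynomials and termwise differentiation -/

open Polynomial in
/-- Inside `(-1, 1)` the `j`-th derivative of `T_n` is of order `n ^ j`. -/
theorem exists_abs_iterate_derivative_T_le {δ : ℝ} (hδ' : δ < 1) (j : ℕ) :
    ∃ C, 0 ≤ C ∧ ∀ n : ℕ, 1 ≤ n → ∀ x : ℝ, |x| ≤ δ →
      |(derivative^[j] (Chebyshev.T ℝ n)).eval x| ≤ C * (n : ℝ) ^ j := by
  have hpos : ∀ x : ℝ, |x| ≤ δ → 0 < 1 - δ ^ 2 ∧ 1 - δ ^ 2 ≤ 1 - x ^ 2 ∧ 1 - x ^ 2 ≤ 1 ∧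
      |x| ≤ 1 := fun x hx => by
    have h0 := abs_nonneg x
    have := sq_abs x
    refine ⟨by nlinarith, by nlinarith, by nlinarith, by linarith⟩
  induction j using Nat.strong_induction_on with
  | _ j ih =>
  match j with
  | 0 =>
    refine ⟨1, zero_le_one, fun n _ x hx => ?_⟩
    simpa using Chebyshev.abs_eval_T_real_le_one n (hpos x hx).2.2.2
  | 1 =>
    -- The absolute value keeps the constant nonnegative also for `δ < -1`, when no `x` satisfies
    -- `|x| ≤ δ`.
    refine ⟨|(1 - δ ^ 2)⁻¹|, abs_nonneg _, fun n _ x hx => ?_⟩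
    obtain ⟨h1, h2, h3, h4⟩ := hpos x hx
    rw [abs_of_pos (inv_pos.2 h1), inv_mul_eq_div, le_div_iff₀ h1]
    obtain ⟨hx1, hx2⟩ := abs_le.1 h4
    -- `T_n' = n U_{n-1}` and `U_{n-1}(cos θ) sin θ = sin (nθ)`, with `sin θ = √(1 - x²)` bounded
    -- below.
    have hU := Chebyshev.U_real_cos (arccos x) ((n : ℤ) - 1)
    rw [cos_arccos hx1 hx2, sin_arccos] at hU
    have hs : 1 - δ ^ 2 ≤ √(1 - x ^ 2) := by
      refine le_sqrt_of_sq_le ?_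
      nlinarith
    simp only [Function.iterate_one, Chebyshev.T_derivative_eq_U, eval_mul, pow_one]
    simp only [Int.cast_natCast, eval_natCast, abs_mul, Nat.abs_cast]
    rw [mul_assoc]
    refine mul_le_of_le_one_right (Nat.cast_nonneg n) ?_
    refine (mul_le_mul_of_nonneg_left hs (abs_nonneg _)).trans ?_
    rw [← abs_of_nonneg (sqrt_nonneg (1 - x ^ 2)), ← abs_mul, hU]
    exact abs_sin_le_one _
  | k + 2 =>
    obtain ⟨C, hC0, hC⟩ := ih k (by omega)
    obtain ⟨C', hC0', hC'⟩ := ih (k + 1) (by omega)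
    refine ⟨|(1 - δ ^ 2)⁻¹| * ((2 * k + 1) * C' + (1 + k ^ 2) * C), by positivity,
      fun n hn x hx => ?_⟩
    obtain ⟨h1, h2, h3, h4⟩ := hpos x hx
    rw [abs_of_pos (inv_pos.2 h1), mul_assoc, inv_mul_eq_div, le_div_iff₀ h1]
    have hn1 : (1 : ℝ) ≤ n := by exact_mod_cast hn
    have b := hC n hn x hx
    have b' := hC' n hn x hx
    -- The Chebyshev differential equation, differentiated `k` times: two more derivatives cost a
    -- factor `n²`, and the leading coefficient `1 - x²` stays away from zero.
    have hrec := Chebyshev.one_sub_X_sq_mul_iterate_derivative_T_eval (R := ℝ) n k x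
    calc |eval x (derivative^[k + 2] (Chebyshev.T ℝ n))| * (1 - δ ^ 2)
        ≤ |eval x (derivative^[k + 2] (Chebyshev.T ℝ n))| * (1 - x ^ 2) :=
          mul_le_mul_of_nonneg_left h2 (abs_nonneg _)
      _ = |(1 - x ^ 2) * eval x (derivative^[k + 2] (Chebyshev.T ℝ n))| := by
          rw [abs_mul, abs_of_pos (h1.trans_le h2), mul_comm]
      _ ≤ (2 * k + 1) * |x| * |eval x (derivative^[k + 1] (Chebyshev.T ℝ n))| +
          |(n : ℝ) ^ 2 - k ^ 2| * |eval x (derivative^[k] (Chebyshev.T ℝ n))| := by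
          rw [hrec]
          refine (abs_sub _ _).trans_eq ?_
          rw [abs_mul, abs_mul, abs_mul, abs_of_nonneg (by positivity : (0 : ℝ) ≤ 2 * k + 1)]
          simp
      _ ≤ (2 * k + 1) * 1 * (C' * (n : ℝ) ^ (k + 1)) +
          ((1 + k ^ 2) * (n : ℝ) ^ 2) * (C * (n : ℝ) ^ k) := by
          have hnk : |(n : ℝ) ^ 2 - k ^ 2| ≤ (1 + k ^ 2) * (n : ℝ) ^ 2 := by
            refine (abs_sub _ _).trans ?_
            rw [abs_of_nonneg (by positivity), abs_of_nonneg (by positivity)]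
            have : (1 : ℝ) ≤ (n : ℝ) ^ 2 := one_le_pow₀ hn1
            nlinarith [sq_nonneg (k : ℝ)]
          gcongr
      _ ≤ (2 * k + 1) * 1 * (C' * (n : ℝ) ^ (k + 2)) +
          ((1 + k ^ 2) * (n : ℝ) ^ 2) * (C * (n : ℝ) ^ k) := by
          gcongr
          omega
      _ = ((2 * k + 1) * C' + (1 + k ^ 2) * C) * (n : ℝ) ^ (k + 2) := by ring

theorem summable_of_abs_le_div_pow {a : ℕ → ℝ} {C : ℝ} {q : ℕ} (hq : 2 ≤ q)
    (ha : ∀ n : ℕ, 1 ≤ n → |a n| ≤ C / (n : ℝ) ^ q) : Summable a := by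
  rw [← summable_nat_add_iff 1]
  refine Summable.of_norm_bounded (g := fun n : ℕ => C / ((n + 1 : ℕ) : ℝ) ^ q) ?_
    fun n => ha (n + 1) (by omega)
  rw [summable_nat_add_iff 1 (f := fun n : ℕ => C / (n : ℝ) ^ q)]
  simp only [div_eq_mul_inv]
  exact (summable_nat_pow_inv.2 (by omega)).mul_left C

/-- Termwise differentiation of the Chebyshev series inside `(-1, 1)`. -/
theorem hasSum_iterate_derivative_chebyshevSeries {f : ℝ → ℝ} (hf : ContinuousOn f (Icc (-1) 1))
    {q : ℕ} {C : ℝ} (hC0 : 0 ≤ C)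
    (hC : ∀ n : ℕ, 1 ≤ n → |chebyshevCoeff f n| ≤ C / (n : ℝ) ^ (q + 2))
    {δ : ℝ} (hδ' : δ < 1) {j : ℕ} (hj : j ≤ q) {x : ℝ} (hx : x ∈ Ioo (-δ) δ) :
    HasSum (fun n : ℕ => chebyshevSeriesCoeff f n *
      (Polynomial.derivative^[j] (Polynomial.Chebyshev.T ℝ n)).eval x)
      (iteratedDerivWithin j f (Icc (-1) 1) x) := by
  have hsub : Ioo (-δ) δ ⊆ Ioo (-1) 1 := Ioo_subset_Ioo (by linarith) hδ'.le
  induction j generalizing x with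
  | zero =>
    simpa using hasSum_chebyshevSeries hf (summable_of_abs_le_div_pow (by omega) hC)
      (Ioo_subset_Icc_self (hsub hx))
  | succ j ih =>
    obtain ⟨K, hK0, hK⟩ := exists_abs_iterate_derivative_T_le hδ' (j + 1)
    have hu : Summable fun n : ℕ => C * K * ((n : ℝ) ^ 2)⁻¹ :=
      (summable_nat_pow_inv.2 (by omega)).mul_left _
    have hbound : ∀ (n : ℕ) (y : ℝ), y ∈ Ioo (-δ) δ → ‖chebyshevSeriesCoeff f n *
        (Polynomial.derivative^[j + 1] (Polynomial.Chebyshev.T ℝ n)).eval y‖ ≤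
        C * K * ((n : ℝ) ^ 2)⁻¹ := fun n y hy => by
      -- At `n = 0` the majorant is `0` by the convention for inverses, which suffices since `T_0`
      -- is constant.
      rcases Nat.eq_zero_or_pos n with rfl | hn
      · simp
      have hn1 : (1 : ℝ) ≤ n := by exact_mod_cast hn
      rw [chebyshevSeriesCoeff, if_neg hn.ne', norm_mul]
      have hab : |y| ≤ δ := abs_le.2 ⟨hy.1.le, hy.2.le⟩
      calc ‖chebyshevCoeff f n‖ *
            ‖(Polynomial.derivative^[j + 1] (Polynomial.Chebyshev.T ℝ n)).eval y‖
          ≤ (C / (n : ℝ) ^ (q + 2)) * (K * (n : ℝ) ^ (j + 1)) :=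
            mul_le_mul (hC n hn) (hK n hn y hab) (norm_nonneg _) (by positivity)
        _ ≤ (C / (n : ℝ) ^ (q + 2)) * (K * (n : ℝ) ^ q) := by gcongr
        _ = C * K * ((n : ℝ) ^ 2)⁻¹ := by rw [pow_add]; field_simp
    have hd := hasDerivAt_tsum_of_isPreconnected hu isOpen_Ioo isPreconnected_Ioo
      (g := fun n y => chebyshevSeriesCoeff f n *
        (Polynomial.derivative^[j] (Polynomial.Chebyshev.T ℝ n)).eval y)
      (g' := fun n y => chebyshevSeriesCoeff f n *
        (Polynomial.derivative^[j + 1] (Polynomial.Chebyshev.T ℝ n)).eval y)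
      (fun n y _ => by
        rw [Function.iterate_succ_apply']
        exact (Polynomial.hasDerivAt _ y).const_mul _)
      hbound hx (ih (by omega) hx).summable hx
    have hd' : HasDerivAt (iteratedDerivWithin j f (Icc (-1) 1)) _ x :=
      hd.congr_of_eventuallyEq (by
        filter_upwards [isOpen_Ioo.mem_nhds hx] with y hy
        exact (ih (by omega) hy).tsum_eq.symm)
    have huniq : UniqueDiffWithinAt ℝ (Icc (-1 : ℝ) 1) x :=
      uniqueDiffOn_Icc (by norm_num) x (Ioo_subset_Icc_self (hsub hx))
    rw [iteratedDerivWithin_succ, hd'.hasDerivWithinAt.derivWithin huniq]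
    exact (Summable.of_norm_bounded hu fun n => hbound n x hx).hasSum

/-! ### Polynomials of Jordan blocks -/

theorem jordanBlock_eq_add_algebraMap (s : ℕ) (μ : ℝ) :
    jordanBlock s μ = jordanBlock s 0 + algebraMap ℝ _ μ := by
  ext a b
  simp only [jordanBlock, Matrix.of_apply, Matrix.add_apply, Matrix.algebraMap_matrix_apply]
  split_ifs <;> simp

theorem jordanBlock_zero_pow_apply (s n : ℕ) (a b : Fin s) :
    (jordanBlock s 0 ^ n) a b = if (a : ℕ) + n = b then 1 else 0 := by
  induction n generalizing a with
  | zero => simp [Matrix.one_apply, Fin.ext_iff]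
  | succ n ih =>
    rw [pow_succ', Matrix.mul_apply]
    simp only [ih]
    by_cases h : (a : ℕ) + 1 < s
    · rw [Finset.sum_eq_single ⟨a + 1, h⟩]
      · have : a ≠ ⟨a + 1, h⟩ := fun h' => by simp [Fin.ext_iff] at h'
        simp [jordanBlock, this, add_assoc, add_comm 1 n]
      · intro c _ hc
        have : (a : ℕ) + 1 ≠ c := fun h' => hc (Fin.ext h'.symm)
        simp [jordanBlock, this]
      · simp
    · rw [Finset.sum_eq_zero fun c _ => ?_, if_neg (by omega)]
      have : (a : ℕ) + 1 ≠ c := by omega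
      have hac : (if a = c then (0 : ℝ) else if (a : ℕ) + 1 = c then 1 else 0) = 0 := by
        simp [this]
      rw [jordanBlock, Matrix.of_apply, hac, zero_mul]

-- Taylor expansion at `μ`, evaluated at the nilpotent shift, whose `j`-th power is the `j`-th
-- superdiagonal.
open Polynomial in
theorem aeval_jordanBlock_apply (s : ℕ) (μ : ℝ) (P : ℝ[X]) (a b : Fin s) :
    aeval (jordanBlock s μ) P a b =
      if a ≤ b then (derivative^[(b : ℕ) - a] P).eval μ / (((b : ℕ) - a).factorial : ℝ)
      else 0 := by
  have h : aeval (jordanBlock s μ) P = aeval (jordanBlock s 0) (taylor μ P) := by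
    rw [taylor_apply, aeval_comp, map_add, aeval_X, aeval_C, ← jordanBlock_eq_add_algebraMap]
  have hco : ∀ j, (taylor μ P).coeff j = (derivative^[j] P).eval μ / (j.factorial : ℝ) := fun j => by
    rw [taylor_coeff, eq_div_iff (by positivity), ← factorial_smul_hasseDeriv]
    simp [mul_comm]
  rw [h, aeval_eq_sum_range, Matrix.sum_apply]
  simp only [Matrix.smul_apply, jordanBlock_zero_pow_apply, smul_eq_mul, mul_ite, mul_one,
    mul_zero]
  split_ifs with hab
  · have hab' : (a : ℕ) ≤ b := hab
    rw [← hco, Finset.sum_congr rfl fun j _ => if_congr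
      (show (a : ℕ) + j = b ↔ (b : ℕ) - a = j by omega) rfl rfl, Finset.sum_ite_eq]
    split_ifs with hj
    · rfl
    · rw [coeff_eq_zero_of_natDegree_lt]
      have := Finset.mem_range.not.1 hj
      omega
  · refine Finset.sum_eq_zero fun j _ => if_neg ?_
    have : ¬ (a : ℕ) ≤ b := hab
    omega

/-! ### Jordan structure of condense matrices and norm comparisons -/

namespace JordanDecomposition

variable {k : ℕ} {A : Matrix (Fin k) (Fin k) ℝ}

/-- The algebra homomorphism `B ↦ Z⁻¹ diag(B) Z`. -/
noncomputable def conjBlockDiag (D : JordanDecomposition A) :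
    (∀ i, Matrix (Fin (D.size i)) (Fin (D.size i)) ℝ) →ₐ[ℝ] Matrix (Fin k) (Fin k) ℝ :=
  AlgHom.ofLinearMap
    { toFun := fun B => (D.Z⁻¹).val * D.blockDiag B * D.Z.val
      map_add' := fun B C => by
        have : D.blockDiag (B + C) = D.blockDiag B + D.blockDiag C := by
          simp [blockDiag, Matrix.blockDiagonal'_add, Matrix.submatrix_add]
        rw [this, mul_add, add_mul]
      map_smul' := fun r B => by
        have : D.blockDiag (r • B) = r • D.blockDiag B := by
          simp [blockDiag, Matrix.blockDiagonal'_smul, Matrix.submatrix_smul]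
        rw [this]; simp }
    (by
      have : D.blockDiag 1 = 1 := by
        simp [blockDiag, Matrix.blockDiagonal'_one]
      simp [this])
    (fun B C => by
      have : D.blockDiag (B * C) = D.blockDiag B * D.blockDiag C := by
        simp only [blockDiag, Matrix.reindex_apply, Matrix.submatrix_mul_equiv,
          ← Matrix.blockDiagonal'_mul]
        rfl
      simp only [LinearMap.coe_mk, AddHom.coe_mk, this]
      simp [mul_assoc])

theorem conjBlockDiag_apply (D : JordanDecomposition A)
    (B : ∀ i, Matrix (Fin (D.size i)) (Fin (D.size i)) ℝ) :
    D.conjBlockDiag B = (D.Z⁻¹).val * D.blockDiag B * D.Z.val := rfl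

theorem eq_conjBlockDiag (D : JordanDecomposition A) :
    A = D.conjBlockDiag fun i => jordanBlock (D.size i) (D.ev i) := D.eq

theorem aeval_eq (D : JordanDecomposition A) (P : Polynomial ℝ) :
    Polynomial.aeval A P =
      D.conjBlockDiag fun i => Polynomial.aeval (jordanBlock (D.size i) (D.ev i)) P := by
  conv_lhs => rw [D.eq_conjBlockDiag]
  rw [Polynomial.aeval_algHom_apply]
  congr 1
  ext1 i
  exact (Polynomial.aeval_algHom_apply (Pi.evalAlgHom ℝ _ i) _ P).symm

/-- The columns of `Z⁻¹`, numbered by the rows of the blocks. -/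
noncomputable def basisVec (D : JordanDecomposition A) (x : Σ i, Fin (D.size i)) : Fin k → ℝ :=
  (D.Z⁻¹).val.mulVec (Pi.single (D.e x) 1)

theorem basisVec_ne_zero (D : JordanDecomposition A) (x : Σ i, Fin (D.size i)) :
    D.basisVec x ≠ 0 := fun h => by
  have h1 := congrArg D.Z.val.mulVec h
  rw [basisVec, Matrix.mulVec_mulVec, Units.mul_inv, Matrix.one_mulVec, Matrix.mulVec_zero] at h1
  have := congrFun h1 (D.e x)
  simp at this

/-- The Jordan chain relation. Its start shows that each `ev i` is an eigenvalue; its second vector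
detects failure of semisimplicity. -/
theorem sub_smul_mulVec_basisVec (D : JordanDecomposition A) (i : Fin D.p)
    (b : Fin (D.size i)) :
    (A - D.ev i • 1).mulVec (D.basisVec ⟨i, b⟩) =
      if h : 0 < (b : ℕ) then D.basisVec ⟨i, ⟨b - 1, by omega⟩⟩ else 0 := by
  have hA : A - D.ev i • 1 =
      D.conjBlockDiag fun j => jordanBlock (D.size j) (D.ev j) - D.ev i • 1 := by
    have h1 : D.conjBlockDiag (D.ev i • 1) = D.ev i • 1 := by rw [map_smul, map_one]
    calc A - D.ev i • 1 = D.conjBlockDiag (fun j => jordanBlock (D.size j) (D.ev j)) -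
          D.conjBlockDiag (D.ev i • 1) := by rw [h1, ← D.eq_conjBlockDiag]
      _ = _ := (map_sub D.conjBlockDiag _ _).symm
  have hcol : (D.blockDiag fun j => jordanBlock (D.size j) (D.ev j) - D.ev i • 1).mulVec
      (Pi.single (D.e ⟨i, b⟩) 1) =
      if h : 0 < (b : ℕ) then Pi.single (D.e ⟨i, ⟨b - 1, by omega⟩⟩) 1 else 0 := by
    rw [Matrix.mulVec_single_one]
    ext r
    obtain ⟨⟨j, a⟩, rfl⟩ := D.e.surjective r
    have hL : (D.blockDiag fun j => jordanBlock (D.size j) (D.ev j) - D.ev i • 1).col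
        (D.e ⟨i, b⟩) (D.e ⟨j, a⟩) = Matrix.blockDiagonal'
          (fun j => jordanBlock (D.size j) (D.ev j) - D.ev i • 1) ⟨j, a⟩ ⟨i, b⟩ := by
      simp [blockDiag]
    rw [hL]
    by_cases hji : j = i
    · subst hji
      rw [Matrix.blockDiagonal'_apply_eq]
      simp only [jordanBlock, Matrix.sub_apply, Matrix.of_apply, Matrix.smul_apply,
        Matrix.one_apply]
      split_ifs with h1 h2 h3 h3
      · simp [Pi.single_apply, h1, Fin.ext_iff]; omega
      · simp
      · simp [Pi.single_apply, Fin.ext_iff]; omega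
      · omega
      · simp [Pi.single_apply, Fin.ext_iff]; omega
      · simp
    · rw [Matrix.blockDiagonal'_apply_ne _ _ _ hji]
      split_ifs with h1
      · simp [hji]
      · simp
  rw [hA, conjBlockDiag_apply, basisVec, Matrix.mulVec_mulVec, mul_assoc, Units.mul_inv, mul_one,
    ← Matrix.mulVec_mulVec, hcol]
  split_ifs with h
  · rfl
  · simp

theorem toLin'_sub_apply (A : Matrix (Fin k) (Fin k) ℝ) (μ : ℝ) (v : Fin k → ℝ) :
    (Matrix.toLin' A - μ • (1 : Module.End ℝ (Fin k → ℝ))) v = (A - μ • 1).mulVec v := by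
  simp [Matrix.sub_mulVec, Matrix.smul_mulVec]

theorem hasEigenvalue_ev (D : JordanDecomposition A) (i : Fin D.p) :
    Module.End.HasEigenvalue (Matrix.toLin' A) (D.ev i) := by
  refine Module.End.hasEigenvalue_of_hasEigenvector
    (x := D.basisVec ⟨i, ⟨0, D.size_pos i⟩⟩) ⟨?_, D.basisVec_ne_zero _⟩
  rw [Module.End.mem_eigenspace_iff, ← sub_eq_zero]
  have := D.sub_smul_mulVec_basisVec i ⟨0, D.size_pos i⟩
  rw [← toLin'_sub_apply] at this
  simpa using this

theorem abs_ev_le_one (D : JordanDecomposition A) (hA : spectralRadius ℝ A ≤ 1) (i : Fin D.p) :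
    |D.ev i| ≤ 1 := by
  have h1 := (D.hasEigenvalue_ev i).mem_spectrum
  rw [Matrix.spectrum_toLin'] at h1
  have h2 : (‖D.ev i‖₊ : ENNReal) ≤ 1 :=
    (le_iSup₂ (f := fun (μ : ℝ) (_ : μ ∈ spectrum ℝ A) => (‖μ‖₊ : ENNReal)) _ h1).trans hA
  exact_mod_cast h2

/-- The generalized eigenspace has the algebraic multiplicity as its dimension, so it equals the
eigenspace. In a larger block the second chain vector would be killed by `(A - λ)²` but not by `A -
λ`. -/
theorem size_eq_one_of_semisimple (D : JordanDecomposition A) (i : Fin D.p)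
    (h : A.charpoly.rootMultiplicity (D.ev i) =
      Module.finrank ℝ (Module.End.eigenspace (Matrix.toLin' A) (D.ev i))) :
    D.size i = 1 := by
  by_contra hne
  have h1 : 1 < D.size i := by have := D.size_pos i; omega
  have hle : Module.End.eigenspace (Matrix.toLin' A) (D.ev i) ≤
      Module.End.maxGenEigenspace (Matrix.toLin' A) (D.ev i) :=
    Module.End.genEigenspace_le_maximal _ _ 1
  have heq := Submodule.eq_of_le_of_finrank_eq hle (by
    rw [LinearMap.finrank_maxGenEigenspace_eq, Matrix.charpoly_toLin', h])
  have e1 := D.sub_smul_mulVec_basisVec i ⟨1, h1⟩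
  have e0 := D.sub_smul_mulVec_basisVec i ⟨0, D.size_pos i⟩
  simp only [zero_lt_one, dite_true, lt_irrefl, dite_false, ← toLin'_sub_apply,
    Nat.sub_self] at e0 e1
  have hmem : D.basisVec ⟨i, ⟨1, h1⟩⟩ ∈ Module.End.eigenspace (Matrix.toLin' A) (D.ev i) := by
    rw [heq, Module.End.mem_maxGenEigenspace]
    refine ⟨2, ?_⟩
    rw [pow_two, Module.End.mul_apply, e1, e0]
  rw [Module.End.mem_eigenspace_iff, ← sub_eq_zero] at hmem
  refine D.basisVec_ne_zero ⟨i, ⟨0, D.size_pos i⟩⟩ ?_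
  rw [← e1, ← hmem]
  simp

/-- The form in which condensedness enters the estimates: derivatives are needed only at points with
`|λ| < δ`. -/
theorem size_eq_one_or_abs_ev_lt (D : JordanDecomposition A) {δ : ℝ} (hA : IsCondense δ A)
    (i : Fin D.p) : D.size i = 1 ∨ |D.ev i| < δ := by
  refine or_iff_not_imp_right.2 fun h => D.size_eq_one_of_semisimple i
    (hA.semisimple _ (D.hasEigenvalue_ev i) ?_)
  have h1 := abs_le.1 (D.abs_ev_le_one hA.spectralRadius_le i)
  rcases le_abs.1 (not_lt.1 h) with h2 | h2
  · exact Or.inr ⟨h2, h1.2⟩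
  · exact Or.inl ⟨h1.1, by linarith⟩

theorem size_le_maxBlockSize (D : JordanDecomposition A) (i : Fin D.p) :
    D.size i ≤ D.maxBlockSize := Finset.le_sup (Finset.mem_univ i)

theorem norm_conjBlockDiag_le (D : JordanDecomposition A)
    (ν : AlgebraNorm ℝ (Matrix (Fin k) (Fin k) ℝ))
    (B : ∀ i, Matrix (Fin (D.size i)) (Fin (D.size i)) ℝ) :
    ν (D.conjBlockDiag B) ≤ ν (D.Z⁻¹).val * ν D.Z.val * ν (D.blockDiag B) := by
  rw [conjBlockDiag_apply]
  calc ν ((D.Z⁻¹).val * D.blockDiag B * D.Z.val)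
      ≤ ν (D.Z⁻¹).val * ν (D.blockDiag B) * ν D.Z.val :=
        (map_mul_le_mul ν _ _).trans
          (mul_le_mul_of_nonneg_right (map_mul_le_mul ν _ _) (apply_nonneg ν _))
    _ = _ := by ring

/-- Expansion in matrix units; this compares an arbitrary norm with the entries. -/
theorem norm_le_sum_abs (ν : AlgebraNorm ℝ (Matrix (Fin k) (Fin k) ℝ))
    (X : Matrix (Fin k) (Fin k) ℝ) :
    ν X ≤ ∑ a, ∑ b, |X a b| * ν (Matrix.single a b 1) := by
  conv_lhs => rw [Matrix.matrix_eq_sum_single X]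
  refine (Finset.le_sum_of_subadditive ν (map_zero ν).le (map_add_le_add ν) _ _).trans
    (Finset.sum_le_sum fun a _ => ?_)
  refine (Finset.le_sum_of_subadditive ν (map_zero ν).le (map_add_le_add ν) _ _).trans
    (Finset.sum_le_sum fun b _ => ?_)
  have : Matrix.single a b (X a b) = X a b • Matrix.single a b (1 : ℝ) := by simp
  rw [this, map_smul_eq_mul, norm_eq_abs]

theorem abs_blockDiag_le (D : JordanDecomposition A) {c : ℝ} (hc : 0 ≤ c)
    {B : ∀ i, Matrix (Fin (D.size i)) (Fin (D.size i)) ℝ} (hB : ∀ i a b, |B i a b| ≤ c)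
    (r s : Fin k) : |D.blockDiag B r s| ≤ c := by
  obtain ⟨⟨i, a⟩, rfl⟩ := D.e.surjective r
  obtain ⟨⟨j, b⟩, rfl⟩ := D.e.surjective s
  simp only [blockDiag, Matrix.reindex_apply, Matrix.submatrix_apply, Equiv.symm_apply_apply]
  by_cases h : i = j
  · subst h
    rw [Matrix.blockDiagonal'_apply_eq]
    exact hB _ _ _
  · rw [Matrix.blockDiagonal'_apply_ne _ _ _ h, abs_zero]
    exact hc

/-- Serves only to show that `κ` is finite, so the dependence of this `γ` on the norm and on `k`
does not reach the final constant. -/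
theorem exists_norm_blockDiag_le (D : JordanDecomposition A)
    (ν : AlgebraNorm ℝ (Matrix (Fin k) (Fin k) ℝ)) :
    ∃ γ, ∀ B : ∀ i, Matrix (Fin (D.size i)) (Fin (D.size i)) ℝ,
      (∀ i a b, |B i a b| ≤ 1) → ν (D.blockDiag B) ≤ γ :=
  ⟨∑ a, ∑ b, 1 * ν (Matrix.single a b 1), fun _ hB => (norm_le_sum_abs ν _).trans
    (Finset.sum_le_sum fun a _ => Finset.sum_le_sum fun b _ =>
      mul_le_mul_of_nonneg_right (D.abs_blockDiag_le zero_le_one hB a b) (apply_nonneg ν _))⟩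

theorem norm_blockDiag_le (D : JordanDecomposition A)
    (ν : AlgebraNorm ℝ (Matrix (Fin k) (Fin k) ℝ)) {γ : ℝ}
    (hγ : ∀ B : ∀ i, Matrix (Fin (D.size i)) (Fin (D.size i)) ℝ,
      (∀ i a b, |B i a b| ≤ 1) → ν (D.blockDiag B) ≤ γ) {c : ℝ} (hc : 0 < c)
    {B : ∀ i, Matrix (Fin (D.size i)) (Fin (D.size i)) ℝ} (hB : ∀ i a b, |B i a b| ≤ c) :
    ν (D.blockDiag B) ≤ c * γ := by
  have h1 : D.blockDiag B = c • D.blockDiag (c⁻¹ • B) := by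
    have : D.blockDiag (c⁻¹ • B) = c⁻¹ • D.blockDiag B := by
      simp [blockDiag, Matrix.blockDiagonal'_smul, Matrix.submatrix_smul]
    rw [this, smul_inv_smul₀ hc.ne']
  rw [h1, map_smul_eq_mul, norm_of_nonneg hc.le]
  refine mul_le_mul_of_nonneg_left (hγ _ fun i a b => ?_) hc.le
  simp only [Pi.smul_apply, Matrix.smul_apply, smul_eq_mul, abs_mul, abs_of_pos (inv_pos.2 hc)]
  rw [inv_mul_le_iff₀ hc, mul_one]
  exact hB i a b

/-- Entrywise convergence of the blocks implies convergence in every matrix norm. -/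
theorem tendsto_norm_conjBlockDiag_zero (D : JordanDecomposition A)
    (ν : AlgebraNorm ℝ (Matrix (Fin k) (Fin k) ℝ)) {ι : Type*} {l : Filter ι}
    {B : ι → ∀ i, Matrix (Fin (D.size i)) (Fin (D.size i)) ℝ}
    (hB : ∀ i a b, Tendsto (fun n => B n i a b) l (𝓝 0)) :
    Tendsto (fun n => ν (D.conjBlockDiag (B n))) l (𝓝 0) := by
  have hentry : ∀ r s, Tendsto (fun n => D.blockDiag (B n) r s) l (𝓝 0) := fun r s => by
    obtain ⟨⟨i, a⟩, rfl⟩ := D.e.surjective r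
    obtain ⟨⟨j, b⟩, rfl⟩ := D.e.surjective s
    simp only [blockDiag, Matrix.reindex_apply, Matrix.submatrix_apply, Equiv.symm_apply_apply]
    by_cases h : i = j
    · subst h
      simpa only [Matrix.blockDiagonal'_apply_eq] using hB i a b
    · simpa only [Matrix.blockDiagonal'_apply_ne _ _ _ h] using tendsto_const_nhds
  have hsum : Tendsto (fun n => ν (D.Z⁻¹).val * ν D.Z.val *
      ∑ a, ∑ b, |D.blockDiag (B n) a b| * ν (Matrix.single a b 1)) l
      (𝓝 (ν (D.Z⁻¹).val * ν D.Z.val *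
        ∑ a : Fin k, ∑ b : Fin k, |(0 : ℝ)| * ν (Matrix.single a b 1))) :=
    (tendsto_finsetSum _ fun a _ => tendsto_finsetSum _ fun b _ =>
      (hentry a b).abs.mul_const _).const_mul _
  simp only [abs_zero, zero_mul, Finset.sum_const_zero, mul_zero] at hsum
  exact squeeze_zero (fun n => apply_nonneg ν _) (fun n => (D.norm_conjBlockDiag_le ν _).trans
    (mul_le_mul_of_nonneg_left (norm_le_sum_abs ν _)
      (mul_nonneg (apply_nonneg ν _) (apply_nonneg ν _)))) hsum

end JordanDecomposition

/-! ### Tail estimate and convergence to the matrix function -/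

theorem chebyshevPartialSum_eq_sum_range {k : ℕ} (N : ℕ) (f : ℝ → ℝ)
    (A : Matrix (Fin k) (Fin k) ℝ) :
    chebyshevPartialSum N f A =
      ∑ n ∈ Finset.range (N + 1), chebyshevSeriesCoeff f n • chebyshevMatrix n A := by
  rw [Finset.sum_range_succ', add_comm, chebyshevPartialSum]
  congr 1
  rw [← Finset.Ico_add_one_right_eq_Icc, Finset.range_eq_Ico,
    Finset.sum_Ico_add' (fun n => chebyshevSeriesCoeff f n • chebyshevMatrix n A), zero_add]
  refine Finset.sum_congr rfl fun n hn => ?_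
  have hn0 : n ≠ 0 := by have := Finset.mem_Ico.1 hn; omega
  rw [chebyshevSeriesCoeff, if_neg hn0]

/-- Coefficient decay against matrix growth leaves `n^{-ℓ} n^{-2}`; the first factor is at most `(N
- ℓ)^{-ℓ}` and the second is summable. Here `m` plays the role of the largest block size minus one.
-/
theorem norm_sum_smul_chebyshevMatrix_le {k : ℕ} (ν : AlgebraNorm ℝ (Matrix (Fin k) (Fin k) ℝ))
    (A : Matrix (Fin k) (Fin k) ℝ) {f : ℝ → ℝ} {m ℓ : ℕ} {C κ : ℝ} (hC0 : 0 ≤ C)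
    (hC : ∀ n : ℕ, 1 ≤ n → |chebyshevCoeff f n| ≤ C / (n : ℝ) ^ (m + ℓ + 2))
    (hκ : ∀ n : ℕ, 1 ≤ n → ν (chebyshevMatrix n A) ≤ κ * (n : ℝ) ^ m)
    {N M : ℕ} (hN : ℓ < N) (hNM : N ≤ M) :
    ν (chebyshevPartialSum M f A - chebyshevPartialSum N f A) ≤
      C * (∑' n : ℕ, ((n : ℝ) ^ 2)⁻¹) * κ / ((N : ℝ) - ℓ) ^ ℓ := by
  have hκ0 : 0 ≤ κ := by simpa using (apply_nonneg ν _).trans (hκ 1 le_rfl)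
  have hd : (0 : ℝ) < (N : ℝ) - ℓ := sub_pos.2 (by exact_mod_cast hN)
  rw [chebyshevPartialSum_eq_sum_range, chebyshevPartialSum_eq_sum_range,
    ← Finset.sum_Ico_eq_sub _ (by omega : N + 1 ≤ M + 1)]
  have hterm : ∀ n ∈ Finset.Ico (N + 1) (M + 1),
      ν (chebyshevSeriesCoeff f n • chebyshevMatrix n A) ≤
        C * κ / ((N : ℝ) - ℓ) ^ ℓ * ((n : ℝ) ^ 2)⁻¹ := fun n hn => by
    have hn' := Finset.mem_Ico.1 hn
    have hn1 : 1 ≤ n := by omega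
    have hn0 : (0 : ℝ) < n := by exact_mod_cast hn1
    rw [chebyshevSeriesCoeff, if_neg (by omega), map_smul_eq_mul, norm_eq_abs]
    calc |chebyshevCoeff f n| * ν (chebyshevMatrix n A)
        ≤ C / (n : ℝ) ^ (m + ℓ + 2) * (κ * (n : ℝ) ^ m) :=
          mul_le_mul (hC n hn1) (hκ n hn1) (apply_nonneg ν _) (by positivity)
      _ = C * κ / (n : ℝ) ^ ℓ * ((n : ℝ) ^ 2)⁻¹ := by
          rw [pow_add, pow_add]; field_simp
      _ ≤ C * κ / ((N : ℝ) - ℓ) ^ ℓ * ((n : ℝ) ^ 2)⁻¹ := by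
          have hle : (N : ℝ) - ℓ ≤ n := by
            have h1 : (N : ℝ) ≤ n := by exact_mod_cast (by omega : N ≤ n)
            linarith [(Nat.cast_nonneg ℓ : (0 : ℝ) ≤ ℓ)]
          gcongr
  calc ν (∑ n ∈ Finset.Ico (N + 1) (M + 1), chebyshevSeriesCoeff f n • chebyshevMatrix n A)
      ≤ ∑ n ∈ Finset.Ico (N + 1) (M + 1), C * κ / ((N : ℝ) - ℓ) ^ ℓ * ((n : ℝ) ^ 2)⁻¹ :=
        (Finset.le_sum_of_subadditive ν (map_zero ν).le (map_add_le_add ν) _ _).trans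
          (Finset.sum_le_sum hterm)
    _ ≤ C * κ / ((N : ℝ) - ℓ) ^ ℓ * ∑' n : ℕ, ((n : ℝ) ^ 2)⁻¹ := by
        rw [← Finset.mul_sum]
        refine mul_le_mul_of_nonneg_left ?_ (by positivity)
        exact (summable_nat_pow_inv.2 (by omega)).sum_le_tsum _ fun n _ => by positivity
    _ = _ := by ring

namespace JordanDecomposition

variable {k : ℕ} {A : Matrix (Fin k) (Fin k) ℝ}

theorem chebyshevPartialSum_sub_apply (D : JordanDecomposition A) (f : ℝ → ℝ) (N : ℕ) :
    chebyshevPartialSum N f A - D.apply f = D.conjBlockDiag fun i =>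
      ∑ n ∈ Finset.range (N + 1), chebyshevSeriesCoeff f n •
        Polynomial.aeval (jordanBlock (D.size i) (D.ev i)) (Polynomial.Chebyshev.T ℝ n) -
      functionOfJordanBlock f (D.size i) (D.ev i) := by
  have h1 : D.apply f = D.conjBlockDiag fun i =>
    functionOfJordanBlock f (D.size i) (D.ev i) := rfl
  rw [chebyshevPartialSum_eq_sum_range, h1]
  simp only [chebyshevMatrix, D.aeval_eq, ← map_smul]
  rw [← map_sum, ← map_sub]
  congr 1
  ext1 i
  simp

/-- On `δ`-condense matrices the Chebyshev expansion of a function with rapidly decreasing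
coefficients converges. -/
theorem tendsto_norm_chebyshevPartialSum_sub_apply (D : JordanDecomposition A)
    (ν : AlgebraNorm ℝ (Matrix (Fin k) (Fin k) ℝ)) {δ : ℝ} (hδ' : δ < 1) (hA : IsCondense δ A)
    {f : ℝ → ℝ} (hf : ContinuousOn f (Icc (-1) 1)) {q : ℕ} (hq : D.maxBlockSize ≤ q + 1) {C : ℝ}
    (hC0 : 0 ≤ C) (hC : ∀ n : ℕ, 1 ≤ n → |chebyshevCoeff f n| ≤ C / (n : ℝ) ^ (q + 2)) :
    Tendsto (fun N => ν (chebyshevPartialSum N f A - D.apply f)) atTop (𝓝 0) := by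
  simp only [D.chebyshevPartialSum_sub_apply]
  refine D.tendsto_norm_conjBlockDiag_zero ν fun i a b => ?_
  simp only [Matrix.sub_apply, Matrix.sum_apply, Matrix.smul_apply, smul_eq_mul,
    aeval_jordanBlock_apply, functionOfJordanBlock, Matrix.of_apply]
  split_ifs with hab
  · have hs : HasSum (fun n : ℕ => chebyshevSeriesCoeff f n *
        (Polynomial.derivative^[(b : ℕ) - a] (Polynomial.Chebyshev.T ℝ n)).eval (D.ev i))
        (iteratedDerivWithin ((b : ℕ) - a) f (Icc (-1) 1) (D.ev i)) := by
      -- A block of size one may sit at `±1` but involves no derivative; larger blocks lie where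
      -- termwise differentiation is valid.
      rcases D.size_eq_one_or_abs_ev_lt hA i with h | h
      · have h0 : (b : ℕ) - a = 0 := by omega
        rw [h0]
        simpa using hasSum_chebyshevSeries hf (summable_of_abs_le_div_pow (by omega) hC)
          (abs_le.1 (D.abs_ev_le_one hA.spectralRadius_le i))
      · refine hasSum_iterate_derivative_chebyshevSeries hf hC0 hC hδ' ?_ (abs_lt.1 h)
        have := D.size_le_maxBlockSize i
        omega
    have h1 := ((hs.div_const (((b : ℕ) - a).factorial : ℝ)).tendsto_sum_nat.comp
      (tendsto_add_atTop_nat 1)).sub_const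
      (iteratedDerivWithin ((b : ℕ) - a) f (Icc (-1) 1) (D.ev i) /
        (((b : ℕ) - a).factorial : ℝ))
    rw [sub_self] at h1
    simpa [Function.comp_def, mul_div_assoc] using h1
  · simp

theorem norm_chebyshevPartialSum_sub_apply_le (D : JordanDecomposition A)
    (ν : AlgebraNorm ℝ (Matrix (Fin k) (Fin k) ℝ)) {δ : ℝ} (hδ' : δ < 1) (hA : IsCondense δ A)
    {f : ℝ → ℝ} (hf : ContinuousOn f (Icc (-1) 1)) {m ℓ : ℕ} (hm : D.maxBlockSize ≤ m + 1)
    {C κ : ℝ} (hC0 : 0 ≤ C)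
    (hC : ∀ n : ℕ, 1 ≤ n → |chebyshevCoeff f n| ≤ C / (n : ℝ) ^ (m + ℓ + 2))
    (hκ : ∀ n : ℕ, 1 ≤ n → ν (chebyshevMatrix n A) ≤ κ * (n : ℝ) ^ m) {N : ℕ} (hN : ℓ < N) :
    ν (chebyshevPartialSum N f A - D.apply f) ≤
      C * (∑' n : ℕ, ((n : ℝ) ^ 2)⁻¹) * κ / ((N : ℝ) - ℓ) ^ ℓ := by
  have hlim := (D.tendsto_norm_chebyshevPartialSum_sub_apply ν hδ' hA hf
    (q := m + ℓ) (by omega) hC0 hC).const_add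
    (C * (∑' n : ℕ, ((n : ℝ) ^ 2)⁻¹) * κ / ((N : ℝ) - ℓ) ^ ℓ)
  rw [add_zero] at hlim
  -- The tail bound is uniform in `M`, so `M → ∞` gives the error bound.
  refine ge_of_tendsto hlim ?_
  filter_upwards [eventually_ge_atTop N] with M hM
  have h1 : chebyshevPartialSum N f A - D.apply f =
      -(chebyshevPartialSum M f A - chebyshevPartialSum N f A) +
        (chebyshevPartialSum M f A - D.apply f) := by abel
  rw [h1]
  refine (map_add_le_add ν _ _).trans (add_le_add_left ?_ _)
  rw [map_neg_eq_map]
  exact norm_sum_smul_chebyshevMatrix_le ν A hC0 hC hκ hN hM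

end JordanDecomposition

/-! ### Growth of `T_n(A)` and the main estimate -/

/-- The matrices `T_n(A)` of `δ`-condense matrices with Jordan blocks of size at most `m + 1` are
of order `n ^ m`. -/
theorem exists_norm_chebyshevMatrix_le {δ : ℝ} (hδ' : δ < 1) (m : ℕ) :
    ∃ K : ℝ, 1 ≤ K ∧ ∀ (k : ℕ) (ν : AlgebraNorm ℝ (Matrix (Fin k) (Fin k) ℝ))
      (A : Matrix (Fin k) (Fin k) ℝ), IsCondense δ A →
      ∀ D : JordanDecomposition A, D.maxBlockSize ≤ m + 1 →
      ∀ γ : ℝ, (∀ B : ∀ i, Matrix (Fin (D.size i)) (Fin (D.size i)) ℝ,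
        (∀ i a b, |B i a b| ≤ 1) → ν (D.blockDiag B) ≤ γ) →
      ∀ n : ℕ, 1 ≤ n → ν (chebyshevMatrix n A) ≤
        K * (ν (D.Z⁻¹).val * ν D.Z.val * γ) * (n : ℝ) ^ m := by
  choose K hK0 hK using fun j => exists_abs_iterate_derivative_T_le hδ' j
  have hsum0 : 0 ≤ ∑ j ∈ Finset.range (m + 1), K j := Finset.sum_nonneg fun j _ => hK0 j
  -- The summand `1` covers blocks of size one, where `|T_n| ≤ 1`, and makes the constant at least
  -- `1`.
  refine ⟨1 + ∑ j ∈ Finset.range (m + 1), K j, by linarith, fun k ν A hA D hD γ hγ n hn => ?_⟩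
  set S := 1 + ∑ j ∈ Finset.range (m + 1), K j with hS
  have hn1 : (1 : ℝ) ≤ n := by exact_mod_cast hn
  have hnm : (1 : ℝ) ≤ (n : ℝ) ^ m := one_le_pow₀ hn1
  have hc : 0 < S * (n : ℝ) ^ m := mul_pos (by linarith) (by linarith)
  rw [chebyshevMatrix, D.aeval_eq]
  refine (D.norm_conjBlockDiag_le ν _).trans ?_
  have hB : ν (D.blockDiag fun i => Polynomial.aeval (jordanBlock (D.size i) (D.ev i))
      (Polynomial.Chebyshev.T ℝ n)) ≤ S * (n : ℝ) ^ m * γ := by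
    refine D.norm_blockDiag_le ν hγ hc fun i a b => ?_
    rw [aeval_jordanBlock_apply]
    split_ifs with hab
    · have hfac : (1 : ℝ) ≤ (((b : ℕ) - a).factorial : ℝ) := by
        exact_mod_cast Nat.succ_le_of_lt (Nat.factorial_pos _)
      rw [abs_div, abs_of_pos (zero_lt_one.trans_le hfac)]
      refine (div_le_self (abs_nonneg _) hfac).trans ?_
      rcases D.size_eq_one_or_abs_ev_lt hA i with h | h
      · have h0 : (b : ℕ) - a = 0 := by omega
        rw [h0]
        refine (Polynomial.Chebyshev.abs_eval_T_real_le_one n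
          (D.abs_ev_le_one hA.spectralRadius_le i)).trans ?_
        exact one_le_mul_of_one_le_of_one_le (by linarith) hnm
      · have hj : (b : ℕ) - a < m + 1 := by
          have := D.size_le_maxBlockSize i
          omega
        have h1 : K ((b : ℕ) - a) ≤ S := by
          have := Finset.single_le_sum (fun j _ => hK0 j) (Finset.mem_range.2 hj)
          linarith
        refine (hK _ n hn _ h.le).trans (mul_le_mul h1 ?_ (by positivity) (by linarith))
        exact pow_le_pow_right₀ hn1 (by omega)
    · simpa using hc.le
  refine (mul_le_mul_of_nonneg_left hB
    (mul_nonneg (apply_nonneg ν _) (apply_nonneg ν _))).trans_eq ?_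
  ring

theorem mainTheorem7 (m ℓ : ℕ) (hm : 1 ≤ m) (δ : ℝ) (hδ : 0 < δ) (hδ' : δ < 1)
    (f : ℝ → ℝ) (hf : HasBVDerivative (m + ℓ - 1) f) :
    ∃ c : ℝ, 0 ≤ c ∧
      ∀ (k : ℕ) (ν : AlgebraNorm ℝ (Matrix (Fin k) (Fin k) ℝ))
        (A : Matrix (Fin k) (Fin k) ℝ), IsCondense δ A →
        ∀ D : JordanDecomposition A, D.maxBlockSize = m →
          (∃ κ : ℝ,
            IsLUB {x : ℝ | ∃ n : ℕ, 1 ≤ n ∧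
              x = ν (chebyshevMatrix n A) / (n : ℝ) ^ (m - 1)} κ ∧
            ∀ N : ℕ, ℓ < N →
              ν (chebyshevPartialSum N f A - D.apply f) ≤ c * κ / ((N : ℝ) - ℓ) ^ ℓ) ∧
          (∀ γ : ℝ,
            (∀ B : ∀ i, Matrix (Fin (D.size i)) (Fin (D.size i)) ℝ,
              (∀ i a b, |B i a b| ≤ 1) → ν (D.blockDiag B) ≤ γ) →
            ∀ N : ℕ, ℓ < N →
              ν (chebyshevPartialSum N f A - D.apply f) ≤
                c * (ν (D.Z⁻¹).val * ν D.Z.val * γ) /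
                  ((N : ℝ) - ℓ) ^ ℓ) := by
  -- From here on `m` is the largest block size minus one, the growth exponent of `T_n(A)`.
  obtain ⟨m, rfl⟩ : ∃ m', m = m' + 1 := ⟨m - 1, by omega⟩
  rw [show m + 1 + ℓ - 1 = m + ℓ by omega] at hf
  rw [Nat.add_sub_cancel]
  obtain ⟨C, hC0, hC⟩ := hf.exists_abs_chebyshevCoeff_le
  obtain ⟨K, hK1, hK⟩ := exists_norm_chebyshevMatrix_le hδ' m
  set S := ∑' n : ℕ, ((n : ℝ) ^ 2)⁻¹ with hS
  have hS0 : 0 ≤ S := tsum_nonneg fun n => by positivity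
  -- The factor `K` is needed for the bound with `γ`; the bound with `κ` tolerates it because `K ≥
  -- 1`.
  refine ⟨C * S * K, by positivity, fun k ν A hA D hD => ?_⟩
  have hest : ∀ κ, (∀ n : ℕ, 1 ≤ n → ν (chebyshevMatrix n A) ≤ κ * (n : ℝ) ^ m) →
      ∀ N : ℕ, ℓ < N → ν (chebyshevPartialSum N f A - D.apply f) ≤
        C * S * κ / ((N : ℝ) - ℓ) ^ ℓ := fun κ hκ N hN =>
    D.norm_chebyshevPartialSum_sub_apply_le ν hδ' hA hf.contDiffOn.continuousOn hD.le hC0 hC hκ hN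
  refine ⟨?_, fun γ hγ N hN => ?_⟩
  · set X := {x : ℝ | ∃ n : ℕ, 1 ≤ n ∧ x = ν (chebyshevMatrix n A) / (n : ℝ) ^ m} with hX
    obtain ⟨γ, hγ⟩ := D.exists_norm_blockDiag_le ν
    have hbdd : BddAbove X := by
      refine ⟨K * (ν (D.Z⁻¹).val * ν D.Z.val * γ), ?_⟩
      rintro x ⟨n, hn, rfl⟩
      have hn0 : (0 : ℝ) < n := by exact_mod_cast hn
      rw [div_le_iff₀ (by positivity)]
      exact hK k ν A hA D hD.le γ hγ n hn
    have hlub : IsLUB X (sSup X) := isLUB_csSup ⟨_, 1, le_rfl, rfl⟩ hbdd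
    have hκ0 : 0 ≤ sSup X :=
      (div_nonneg (apply_nonneg ν _) (by positivity)).trans (hlub.1 ⟨1, le_rfl, rfl⟩)
    refine ⟨sSup X, hlub, fun N hN => (hest (sSup X) (fun n hn => ?_) N hN).trans ?_⟩
    · have hn0 : (0 : ℝ) < n := by exact_mod_cast hn
      rw [← div_le_iff₀ (by positivity)]
      exact hlub.1 ⟨n, hn, rfl⟩
    · have hd : (0 : ℝ) < (N : ℝ) - ℓ := sub_pos.2 (by exact_mod_cast hN)
      refine div_le_div_of_nonneg_right (mul_le_mul_of_nonneg_right ?_ hκ0) (by positivity)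
      exact le_mul_of_one_le_right (by positivity) hK1
  · refine (hest _ (fun n hn => hK k ν A hA D hD.le γ hγ n hn) N hN).trans_eq ?_
    ring
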